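/- Let $\mathbb{S}=(\mathbb{N}\cup\{-\infty\},\max,+,-\infty,0)$ be the max-plus semiring, with semiring addition $\oplus=\max$, semiring multiplication $\odot=+$, zero $\mathbb{0}=-\infty$ and one $\mathbb{1}=0$, and let $\Sigma=\{a,b,\#\}$. A weighted automaton consists of a finite set $Q$ of states, a weight function $E:Q\times\Sigma\times Q\to\mathbb{S}$ and initial and final functions $I,F:Q\to\mathbb{S}$. An accepting run over $w=a_1\cdots a_n$ is a sequence of states $q_0,\dots,q_n$ with $I(q_0)\neq\mathbb{0}$, $E(q_{i-1},a_i,q_i)\neq\mathbb{0}$ for $1\le i\le n$, and $F(q_n)\neq\mathbb{0}$; its weight is $I(q_0)\odot\bigodot_{i=1}^{n}E(q_{i-1},a_i,q_i)\odot F(q_n)$. The automaton computes the function that maps $w\in\Sigma^*$ to the $\oplus$-sum of the weights of all accepting runs over $w$ (the empty sum being $\mathbb{0}$). It is linearly ambiguous if there are constants $c,d\in\mathbb{N}$ such that every $w\in\Sigma^*$ has at most $c|w|+d$ accepting runs. A cost register automaton (CRA) consists of a finite set $Q$ of states, a finite set $\mathcal{X}$ of registers, an initial state $q_0$, an initial valuation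 $\nu_0:\mathcal{X}\to\mathbb{S}$, a transition function $\delta$ that assigns to each pair in $Q\times\Sigma$ a state and a substitution $\sigma:\mathcal{X}\to\mathrm{Expr}(\mathcal{X})$, and an output function $\mu:Q\to\mathrm{Expr}(\mathcal{X})$, where $\mathrm{Expr}(\mathcal{X})$ is the set of syntactic expressions built from registers, constants of $\mathbb{S}$, $\oplus$ and $\odot$. It reads its input from left to right; in a transition with substitution $\sigma$ all registers $x$ simultaneously receive the value of $\sigma(x)$ under the current valuation, and after the last letter, in state $q$, the output is the value of $\mu(q)$ under the current valuation. The CRA is copyless if in every expression $\mu(q)$ each register occurs at most once and if, for every substitution $\sigma$ of a transition, each register occurs at most once in each $\sigma(x)$ and no register occurs in both $\sigma(x)$ and $\sigma(y)$ for $x\neq y$. Then: 1. The class of functions $\Sigma^*\to\mathbb{S}$ computed by linearly ambiguous weighted automata is not contained in the class of functions computed by copyless CRA; that is, some function computed by a linearly ambiguous weighted automaton is not computed by any copyless CRA. 2. The class of functions $\Sigma^*\to\mathbb{S}$ computed by copyless CRA is not closed under reverse: there is a function $f$ computed by a copyless CRA such that the function $w\mapsto f(w^r)$, where $w^r$ is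 the reverse of $w$, is not computed by any copyless CRA. -/

import Mathlib

namespace CopylessCRA

/-- Carrier of the max-plus semiring `(ℕ ∪ {-∞}, max, +, -∞, 0)`; `⊥` is `-∞`. -/
def MaxPlus : Type := WithBot ℕ

namespace MaxPlus

/-- The semiring zero is `-∞`. -/
instance : Zero MaxPlus := ⟨(⊥ : WithBot ℕ)⟩

/-- The semiring one is the number `0`. -/
instance : One MaxPlus := ⟨((0 : ℕ) : WithBot ℕ)⟩

/-- Semiring addition is `max`. -/
instance : Add MaxPlus := ⟨fun (x y : WithBot ℕ) => (max x y : WithBot ℕ)⟩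

/-- Semiring multiplication is the usual addition, with `-∞` absorbing. -/
instance : Mul MaxPlus := ⟨fun (x y : WithBot ℕ) => (x + y : WithBot ℕ)⟩

instance : CommSemiring MaxPlus where
  nsmul := nsmulRec
  add_assoc := max_assoc (α := WithBot ℕ)
  add_comm := max_comm (α := WithBot ℕ)
  zero_add := bot_sup_eq (α := WithBot ℕ)
  add_zero := sup_bot_eq (α := WithBot ℕ)
  mul_assoc := add_assoc (G := WithBot ℕ)
  mul_comm := add_comm (G := WithBot ℕ)
  one_mul := zero_add (M := WithBot ℕ)
  mul_one := add_zero (M := WithBot ℕ)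
  zero_mul := WithBot.bot_add (α := ℕ)
  mul_zero := WithBot.add_bot (α := ℕ)
  left_distrib := add_max (α := WithBot ℕ)
  right_distrib := max_add (α := WithBot ℕ)

end MaxPlus

/-- The three-letter alphabet `{a, b, #}`. -/
inductive Letter : Type
  | a
  | b
  | sharp

/-! ### Weighted automata -/

/-- A weighted automaton over the semiring `S` and the alphabet `α` with state set `Q`. -/
structure WeightedAutomaton (S α Q : Type) where
  weight : Q → α → Q → S
  init : Q → S
  final : Q → S

namespace WeightedAutomaton

variable {S α Q : Type} [CommSemiring S]

/-- `ρ 0, …, ρ |w|` is the state sequence of an accepting run over `w`: the initial weight, all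
transition weights and the final weight are different from the semiring zero. A run over a given
word is determined by its state sequence. -/
def IsAcceptingRun (A : WeightedAutomaton S α Q) (w : List α) (ρ : Fin (w.length + 1) → Q) :
    Prop :=
  A.init (ρ 0) ≠ 0 ∧
  (∀ i : Fin w.length, A.weight (ρ i.castSucc) (w.get i) (ρ i.succ) ≠ 0) ∧
  A.final (ρ (Fin.last w.length)) ≠ 0

/-- The weight of a run: initial weight times transition weights times final weight. -/
def runWeight (A : WeightedAutomaton S α Q) (w : List α) (ρ : Fin (w.length + 1) → Q) : S :=
  A.init (ρ 0) * (∏ i : Fin w.length, A.weight (ρ i.castSucc) (w.get i) (ρ i.succ)) *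
    A.final (ρ (Fin.last w.length))

open Classical in
/-- The finite set of accepting runs over `w`. -/
noncomputable def runs [Fintype Q] (A : WeightedAutomaton S α Q) (w : List α) :
    Finset (Fin (w.length + 1) → Q) :=
  Finset.univ.filter (A.IsAcceptingRun w)

/-- The function computed by a weighted automaton. -/
noncomputable def eval [Fintype Q] (A : WeightedAutomaton S α Q) (w : List α) : S :=
  ∑ ρ ∈ A.runs w, A.runWeight w ρ

/-- The number of accepting runs is bounded by a linear function of the length of the word. -/
def IsLinearlyAmbiguous [Fintype Q] (A : WeightedAutomaton S α Q) : Prop :=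
  ∃ c d : ℕ, ∀ w : List α, (A.runs w).card ≤ c * w.length + d

end WeightedAutomaton

/-! ### Cost register automata -/

/-- Syntactic expressions over a semiring `S` with variables in `X`. -/
inductive Expr (S X : Type) : Type
  | const (s : S) : Expr S X
  | var (x : X) : Expr S X
  | add (e₁ e₂ : Expr S X) : Expr S X
  | mul (e₁ e₂ : Expr S X) : Expr S X

namespace Expr

variable {S X : Type}

/-- The list of all occurrences of variables in an expression, with repetitions. -/
def vars : Expr S X → List X
  | const _ => []
  | var x => [x]
  | add e₁ e₂ => e₁.vars ++ e₂.vars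
  | mul e₁ e₂ => e₁.vars ++ e₂.vars

/-- The value of an expression under a valuation of the variables. -/
def eval [CommSemiring S] (ν : X → S) : Expr S X → S
  | const s => s
  | var x => ν x
  | add e₁ e₂ => e₁.eval ν + e₂.eval ν
  | mul e₁ e₂ => e₁.eval ν * e₂.eval ν

/-- An expression is copyless if every variable occurs in it at most once. -/
def IsCopyless (e : Expr S X) : Prop := e.vars.Nodup

end Expr

/-- Substitutions over `X`. -/
abbrev Subst (S X : Type) : Type := X → Expr S X

/-- A substitution is copyless if each of its expressions is copyless and no variable occurs in
the expressions of two different registers. -/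
def Subst.IsCopyless {S X : Type} (σ : Subst S X) : Prop :=
  (∀ x, (σ x).IsCopyless) ∧ ∀ x y, x ≠ y → List.Disjoint (σ x).vars (σ y).vars

/-- A cost register automaton over the semiring `S` and the alphabet `α` with state set `Q` and
register set `X`. -/
structure CRA (S α Q X : Type) where
  step : Q → α → Q × Subst S X
  start : Q
  initVal : X → S
  output : Q → Expr S X

namespace CRA

/-- All transition substitutions and all output expressions are copyless. -/
def IsCopyless {S α Q X : Type} (A : CRA S α Q X) : Prop :=
  (∀ q l, (A.step q l).2.IsCopyless) ∧ ∀ q, (A.output q).IsCopyless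

variable {S α Q X : Type} [CommSemiring S]

/-- The successor configuration: all registers are updated simultaneously, each with the value of
its expression under the previous valuation. -/
def next (A : CRA S α Q X) (c : Q × (X → S)) (l : α) : Q × (X → S) :=
  ((A.step c.1 l).1, fun x => ((A.step c.1 l).2 x).eval c.2)

/-- The last configuration of the run over `w`, which reads `w` from left to right. -/
def run (A : CRA S α Q X) (w : List α) : Q × (X → S) :=
  w.foldl A.next (A.start, A.initVal)

/-- The function computed by a cost register automaton. -/
def eval (A : CRA S α Q X) (w : List α) : S :=
  (A.output (A.run w).1).eval (A.run w).2

end CRA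

/-! ### Classes of functions on words -/

/-- The functions computed by linearly ambiguous weighted automata (with finitely many states). -/
def linearlyAmbiguousWA (S α : Type) [CommSemiring S] : Set (List α → S) :=
  {f | ∃ (Q : Type) (_ : Fintype Q) (A : WeightedAutomaton S α Q),
    A.IsLinearlyAmbiguous ∧ ∀ w, f w = A.eval w}

/-- The functions computed by copyless cost register automata (with finitely many states and
finitely many registers). -/
def copylessCRA (S α : Type) [CommSemiring S] : Set (List α → S) :=
  {f | ∃ (Q X : Type) (_ : Finite Q) (_ : Finite X) (A : CRA S α Q X),
    A.IsCopyless ∧ ∀ w, f w = A.eval w}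

/-- A class of functions on words is closed under reverse if it contains, with every `f`, the
function `w ↦ f (w reversed)`. -/
def ClosedUnderReverse {S α : Type} (F : Set (List α → S)) : Prop :=
  ∀ f ∈ F, ∃ g ∈ F, ∀ w, g w = f w.reverse

end CopylessCRA

/-!
Both claims follow from one function `g`. On a word `w` it takes the maximum, over all
factorizations `w = x # u # y` with no `#` in `u`, of the number of `b` in `x` plus the number of
`a` in `u`. A weighted automaton that guesses `x` computes it (`blockWA`), and its accepting runs
are determined by the guess (`blockWA_isLinearlyAmbiguous`). Read from right to left, `g` needs
only two registers, with no copying (`blockCRA`). It remains to see that no copyless CRA computes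
`g` from left to right (`blockWA_eval_not_mem_copylessCRA`). Intuitively, the current number of `b`
is needed both for the candidate `x # u #` and for all later ones.

Up to finitely much information, its profile, a word acts on a copyless CRA by a partial map on the
registers: each register flows into at most one other. Choose a power `v` of `b # a^k #` with
idempotent profile, and let `v'` be `v` with one block `a^k` replaced by a very long block `a^M` in
such a way that the profile is the same. Idempotency forces every register that does not flow into
itself to be constant after `v`. Every other register `y` is updated by an affine map
`y ↦ max (p, q + y)` with `p`, `q` independent of the history, because copylessness excludes products
of `y` with itself. If `q ≤ 0`, then `y` stays bounded along `v ^ i`, and this bound survives `v'`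
and further copies of `v`, since such registers receive values only from bounded ones. If `q ≥ 1`,
then `y` grows with every `v`, after `v'` as well as before. Now consider the words
`v ^ i v' v ^ 2` and `v ^ i v' v ^ 3`. The output is monotone in the registers, so by
`Expr.exists_threshold` it is either bounded in `i`, or strictly larger on the second word
(`CRA.IsCopyless.exists_bound`). But `g` has the same value on both words, since `a^M` dominates
all blocks after it, and this value is unbounded in `i` (`blockWA_eval_block`).
-/

namespace CopylessCRA

/-! ### Order on the max-plus semiring -/

namespace MaxPlus

/-- The usual order, with `0 = -∞` as least element. -/
instance : LinearOrder MaxPlus := inferInstanceAs (LinearOrder (WithBot ℕ))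

/-- The natural number `n` as an element of the max-plus semiring. -/
def ofNat (n : ℕ) : MaxPlus := (n : WithBot ℕ)

theorem zero_le (x : MaxPlus) : 0 ≤ x := bot_le (α := WithBot ℕ)

theorem add_le_iff {x y z : MaxPlus} : x + y ≤ z ↔ x ≤ z ∧ y ≤ z :=
  max_le_iff (α := WithBot ℕ)

theorem le_add_left (x y : MaxPlus) : x ≤ y + x := le_max_right (α := WithBot ℕ) y x

theorem le_add_right (x y : MaxPlus) : x ≤ x + y := le_max_left (α := WithBot ℕ) x y

theorem add_mono {x y x' y' : MaxPlus} (h : x ≤ x') (h' : y ≤ y') : x + y ≤ x' + y' :=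
  max_le_max (α := WithBot ℕ) h h'

theorem mul_mono {x y x' y' : MaxPlus} (h : x ≤ x') (h' : y ≤ y') : x * y ≤ x' * y' :=
  add_le_add (α := WithBot ℕ) h h'

theorem add_eq_right {x y : MaxPlus} (h : x ≤ y) : x + y = y := max_eq_right (α := WithBot ℕ) h

theorem add_eq_left {x y : MaxPlus} (h : y ≤ x) : x + y = x := max_eq_left (α := WithBot ℕ) h

theorem ofNat_mul (m n : ℕ) : ofNat m * ofNat n = ofNat (m + n) := rfl

theorem ofNat_le {m n : ℕ} : ofNat m ≤ ofNat n ↔ m ≤ n := WithBot.coe_le_coe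

theorem ofNat_ne_zero (n : ℕ) : ofNat n ≠ 0 := WithBot.coe_ne_bot

instance : Nontrivial MaxPlus := ⟨1, 0, ofNat_ne_zero 0⟩

theorem exists_eq_ofNat {x : MaxPlus} (h : x ≠ 0) : ∃ n, x = ofNat n := by
  obtain ⟨n, hn⟩ := WithBot.ne_bot_iff_exists.1 h
  exact ⟨n, hn.symm⟩

theorem exists_le_ofNat (x : MaxPlus) : ∃ n, x ≤ ofNat n := by
  by_cases h : x = 0
  · exact ⟨0, h ▸ zero_le _⟩
  · obtain ⟨n, rfl⟩ := exists_eq_ofNat h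
    exact ⟨n, le_rfl⟩

theorem one_le_of_ne_zero {x : MaxPlus} (h : x ≠ 0) : 1 ≤ x := by
  obtain ⟨n, rfl⟩ := exists_eq_ofNat h
  exact ofNat_le.2 n.zero_le

theorem ofNat_one_le_of_not_le {x : MaxPlus} (h : ¬ x ≤ 1) : ofNat 1 ≤ x := by
  by_cases hx : x = 0
  · exact absurd (hx ▸ zero_le 1) h
  · obtain ⟨n, rfl⟩ := exists_eq_ofNat hx
    exact ofNat_le.2 (Nat.one_le_iff_ne_zero.2 fun hn => h (hn ▸ le_rfl))

end MaxPlus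

/-! ### Expressions -/

namespace Expr

variable {S X : Type}

/-- Replace every register `x` in an expression by the expression `σ x`. -/
def subst (σ : Subst S X) : Expr S X → Expr S X
  | const s => const s
  | var x => σ x
  | add e₁ e₂ => add (e₁.subst σ) (e₂.subst σ)
  | mul e₁ e₂ => mul (e₁.subst σ) (e₂.subst σ)

theorem eval_subst [CommSemiring S] (σ : Subst S X) (ν : X → S) (e : Expr S X) :
    (e.subst σ).eval ν = e.eval fun x => (σ x).eval ν := by
  induction e with
  | const s => rfl
  | var x => rfl
  | add e₁ e₂ h₁ h₂ => simp [subst, eval, h₁, h₂]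
  | mul e₁ e₂ h₁ h₂ => simp [subst, eval, h₁, h₂]

theorem vars_subst (σ : Subst S X) (e : Expr S X) :
    (e.subst σ).vars = e.vars.flatMap fun x => (σ x).vars := by
  induction e with
  | const s => rfl
  | var x => simp [subst, vars]
  | add e₁ e₂ h₁ h₂ => simp [subst, vars, h₁, h₂]
  | mul e₁ e₂ h₁ h₂ => simp [subst, vars, h₁, h₂]

theorem mem_vars_subst {σ : Subst S X} {e : Expr S X} {x : X} :
    x ∈ (e.subst σ).vars ↔ ∃ y ∈ e.vars, x ∈ (σ y).vars := by
  simp [vars_subst]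

theorem eval_congr [CommSemiring S] {ν ν' : X → S} (e : Expr S X)
    (h : ∀ x ∈ e.vars, ν x = ν' x) : e.eval ν = e.eval ν' := by
  induction e with
  | const s => rfl
  | var x => exact h x (by simp [vars])
  | add e₁ e₂ h₁ h₂ =>
    simp only [vars, List.mem_append] at h
    simp only [eval]
    rw [h₁ fun x hx => h x (.inl hx), h₂ fun x hx => h x (.inr hx)]
  | mul e₁ e₂ h₁ h₂ =>
    simp only [vars, List.mem_append] at h
    simp only [eval]
    rw [h₁ fun x hx => h x (.inl hx), h₂ fun x hx => h x (.inr hx)]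

/-- A copyless expression is affine in each register when the other registers are fixed. -/
theorem IsCopyless.exists_affine [CommSemiring S] {e : Expr S X} (he : e.IsCopyless) (y : X)
    (ν₀ : X → S) : ∃ p q : S, ∀ ν : X → S, (∀ x ∈ e.vars, x ≠ y → ν x = ν₀ x) →
      e.eval ν = p + q * ν y := by
  induction e with
  | const s => exact ⟨s, 0, fun ν _ => by simp [eval]⟩
  | var x =>
    by_cases hx : x = y
    · subst hx
      exact ⟨0, 1, fun ν _ => by simp [eval]⟩
    · exact ⟨ν₀ x, 0, fun ν h => by simp [eval, h x (by simp [vars]) hx]⟩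
  | add e₁ e₂ h₁ h₂ =>
    simp only [IsCopyless, vars, List.nodup_append] at he
    obtain ⟨p₁, q₁, h₁⟩ := h₁ he.1
    obtain ⟨p₂, q₂, h₂⟩ := h₂ he.2.1
    refine ⟨p₁ + p₂, q₁ + q₂, fun ν h => ?_⟩
    simp only [vars, List.mem_append] at h
    simp only [eval]
    rw [h₁ ν fun x hx => h x (.inl hx), h₂ ν fun x hx => h x (.inr hx)]
    ring
  | mul e₁ e₂ h₁ h₂ =>
    simp only [IsCopyless, vars, List.nodup_append] at he
    obtain ⟨p₁, q₁, h₁⟩ := h₁ he.1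
    obtain ⟨p₂, q₂, h₂⟩ := h₂ he.2.1
    -- `y` is absent from one of the two factors, and that factor is a constant.
    by_cases hy : y ∈ e₁.vars
    · have hy₂ : ∀ x ∈ e₂.vars, x ≠ y := fun x hx hxy => he.2.2 y hy x hx hxy.symm
      refine ⟨p₁ * e₂.eval ν₀, q₁ * e₂.eval ν₀, fun ν h => ?_⟩
      simp only [vars, List.mem_append] at h
      simp only [eval]
      rw [h₁ ν fun x hx => h x (.inl hx), e₂.eval_congr fun x hx => h x (.inr hx) (hy₂ x hx)]
      ring
    · have hy₁ : ∀ x ∈ e₁.vars, x ≠ y := fun x hx hxy => hy (hxy ▸ hx)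
      refine ⟨e₁.eval ν₀ * p₂, e₁.eval ν₀ * q₂, fun ν h => ?_⟩
      simp only [vars, List.mem_append] at h
      simp only [eval]
      rw [h₂ ν fun x hx => h x (.inr hx), e₁.eval_congr fun x hx => h x (.inl hx) (hy₁ x hx)]
      ring

theorem eval_mono {ν ν' : X → MaxPlus} (e : Expr MaxPlus X) (h : ∀ x ∈ e.vars, ν x ≤ ν' x) :
    e.eval ν ≤ e.eval ν' := by
  induction e with
  | const s => exact le_rfl
  | var x => exact h x (by simp [vars])
  | add e₁ e₂ h₁ h₂ =>
    simp only [vars, List.mem_append] at h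
    exact MaxPlus.add_mono (h₁ fun x hx => h x (.inl hx)) (h₂ fun x hx => h x (.inr hx))
  | mul e₁ e₂ h₁ h₂ =>
    simp only [vars, List.mem_append] at h
    exact MaxPlus.mul_mono (h₁ fun x hx => h x (.inl hx)) (h₂ fun x hx => h x (.inr hx))

/-- If the registers outside `Y` are bounded by `C`, then a value of `e` above a threshold that
depends only on `e` and `C` involves a register in `Y`. Hence it grows when all registers in `Y`
grow and no register decreases. -/
theorem exists_threshold (e : Expr MaxPlus X) (Y : Set X) (C : X → MaxPlus) :
    ∃ D : MaxPlus, ∀ ν ν' : X → MaxPlus, (∀ x ∉ Y, ν x ≤ C x) → (∀ x, ν x ≤ ν' x) →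
      (∀ x ∈ Y, MaxPlus.ofNat 1 * ν x ≤ ν' x) →
      e.eval ν ≤ D ∨ MaxPlus.ofNat 1 * e.eval ν ≤ e.eval ν' := by
  induction e with
  | const s => exact ⟨s, fun _ _ _ _ _ => .inl le_rfl⟩
  | var x =>
    refine ⟨C x, fun ν ν' hC _ hY => ?_⟩
    by_cases hx : x ∈ Y
    · exact .inr (hY x hx)
    · exact .inl (hC x hx)
  | add e₁ e₂ h₁ h₂ =>
    obtain ⟨D₁, h₁⟩ := h₁
    obtain ⟨D₂, h₂⟩ := h₂
    refine ⟨D₁ + D₂, fun ν ν' hC hle hY => ?_⟩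
    simp only [eval]
    -- The larger summand is the value of the sum.
    rcases le_total (e₁.eval ν) (e₂.eval ν) with h | h
    · rw [MaxPlus.add_eq_right h]
      exact (h₂ ν ν' hC hle hY).imp (fun h => h.trans (MaxPlus.le_add_left _ _))
        fun h => h.trans (MaxPlus.le_add_left _ _)
    · rw [MaxPlus.add_eq_left h]
      exact (h₁ ν ν' hC hle hY).imp (fun h => h.trans (MaxPlus.le_add_right _ _))
        fun h => h.trans (MaxPlus.le_add_right _ _)
  | mul e₁ e₂ h₁ h₂ =>
    obtain ⟨D₁, h₁⟩ := h₁
    obtain ⟨D₂, h₂⟩ := h₂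
    refine ⟨D₁ * D₂, fun ν ν' hC hle hY => ?_⟩
    simp only [eval]
    rcases h₁ ν ν' hC hle hY with h | h
    · rcases h₂ ν ν' hC hle hY with h' | h'
      · exact .inl (MaxPlus.mul_mono h h')
      · right
        rw [mul_left_comm]
        exact MaxPlus.mul_mono (e₁.eval_mono fun x _ => hle x) h'
    · right
      rw [← mul_assoc]
      exact MaxPlus.mul_mono h (e₂.eval_mono fun x _ => hle x)

end Expr

/-! ### Composition of substitutions -/

namespace Subst

variable {S X : Type}

/-- The substitution with the effect of `σ` followed by `ρ`. -/
def comp (σ ρ : Subst S X) : Subst S X := fun x => (ρ x).subst σ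

theorem IsCopyless.eq_of_mem {σ : Subst S X} (hσ : σ.IsCopyless) {x y z : X}
    (hy : x ∈ (σ y).vars) (hz : x ∈ (σ z).vars) : y = z := by
  by_contra h
  exact hσ.2 y z h hy hz

theorem IsCopyless.comp {σ ρ : Subst S X} (hσ : σ.IsCopyless) (hρ : ρ.IsCopyless) :
    (σ.comp ρ).IsCopyless := by
  refine ⟨fun x => ?_, fun x y hxy z hx hy => ?_⟩
  · simp only [Expr.IsCopyless, Subst.comp, Expr.vars_subst, List.nodup_flatMap]
    exact ⟨fun y _ => hσ.1 y, (hρ.1 x).imp fun h => hσ.2 _ _ h⟩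
  · obtain ⟨u, hu, hzu⟩ := Expr.mem_vars_subst.1 hx
    obtain ⟨v, hv, hzv⟩ := Expr.mem_vars_subst.1 hy
    exact hρ.2 x y hxy hu (hσ.eq_of_mem hzu hzv ▸ hv)

theorem isCopyless_var : Subst.IsCopyless (fun x => .var x : Subst S X) :=
  ⟨fun x => by simp [Expr.IsCopyless, Expr.vars], fun x y h => by simp [Expr.vars, h.symm]⟩

end Subst

/-! ### Powers of words -/

section WordPower

variable {α : Type}

/-- The `n`-fold repetition of a word. -/
def wpow (u : List α) (n : ℕ) : List α := (List.replicate n u).flatten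

theorem wpow_zero (u : List α) : wpow u 0 = [] := rfl

theorem wpow_succ (u : List α) (n : ℕ) : wpow u (n + 1) = u ++ wpow u n := by
  simp [wpow, List.replicate_succ]

theorem wpow_add (u : List α) (m n : ℕ) :
    wpow u (m + n) = wpow u m ++ wpow u n := by
  rw [wpow, wpow, wpow, List.replicate_add, List.flatten_append]

theorem wpow_mul (u : List α) (m n : ℕ) :
    wpow (wpow u m) n = wpow u (m * n) := by
  induction n with
  | zero => rfl
  | succ n ih => rw [wpow_succ, ih, Nat.mul_succ, Nat.add_comm, wpow_add]

end WordPower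

/-! ### Profiles of words -/

namespace CRA

variable {S α Q X : Type}

/-- The state reached from `q` by reading a word, and the composition of the substitutions on the
way. -/
def trans (A : CRA S α Q X) : Q → List α → Q × Subst S X
  | q, [] => (q, fun x => .var x)
  | q, l :: w =>
    ((A.trans (A.step q l).1 w).1, (A.step q l).2.comp (A.trans (A.step q l).1 w).2)

theorem IsCopyless.trans {A : CRA S α Q X} (hA : A.IsCopyless) (q : Q) (w : List α) :
    (A.trans q w).2.IsCopyless := by
  induction w generalizing q with
  | nil => exact Subst.isCopyless_var
  | cons l w ih => exact (hA.1 q l).comp (ih _)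

theorem foldl_next [CommSemiring S] (A : CRA S α Q X) (q : Q) (ν : X → S) (w : List α) :
    w.foldl A.next (q, ν) =
      ((A.trans q w).1, fun x => ((A.trans q w).2 x).eval ν) := by
  induction w generalizing q ν with
  | nil => rfl
  | cons l w ih =>
    rw [List.foldl_cons, next, ih]
    simp [CRA.trans, Subst.comp, Expr.eval_subst]

/-- The profile of a word: for each state, the state reached, and the relation that holds between
`x` and `y` if the old value of the register `x` occurs in the new value of the register `y`. -/
def profile (A : CRA S α Q X) (w : List α) : Q → Q × (X → X → Prop) :=
  fun q => ((A.trans q w).1, fun x y => x ∈ ((A.trans q w).2 y).vars)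

theorem profile_append (A : CRA S α Q X) (u v : List α) (q : Q) :
    A.profile (u ++ v) q = ((A.profile v (A.profile u q).1).1,
      fun x z => ∃ y, (A.profile u q).2 x y ∧ (A.profile v (A.profile u q).1).2 y z) := by
  induction u generalizing q with
  | nil => simp [profile, CRA.trans, Expr.vars]
  | cons l u ih =>
    have h := ih (A.step q l).1
    simp only [profile, Prod.mk.injEq, funext_iff, eq_iff_iff] at h
    simp only [profile, List.cons_append, CRA.trans, Subst.comp, Expr.mem_vars_subst,
      Prod.mk.injEq, funext_iff, eq_iff_iff]
    refine ⟨h.1, fun x z => ⟨?_, ?_⟩⟩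
    · rintro ⟨y, hy, hx⟩
      obtain ⟨t, h1, h2⟩ := (h.2 y z).1 hy
      exact ⟨t, ⟨y, h1, hx⟩, h2⟩
    · rintro ⟨t, ⟨y, h1, hx⟩, h2⟩
      exact ⟨y, (h.2 y z).2 ⟨t, h1, h2⟩, hx⟩

theorem profile_append_congr (A : CRA S α Q X) {u u' v v' : List α}
    (hu : A.profile u = A.profile u') (hv : A.profile v = A.profile v') :
    A.profile (u ++ v) = A.profile (u' ++ v') := by
  funext q
  rw [profile_append, profile_append, hu, hv]

/-- The profiles of the powers of a word are eventually periodic. -/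
theorem exists_profile_periodic [Finite Q] [Finite X] (A : CRA S α Q X) (u : List α) :
    ∃ i p, 0 < p ∧ ∀ m, A.profile (wpow u (i + p * m)) = A.profile (wpow u i) := by
  obtain ⟨i, j, hij, h⟩ := Finite.exists_ne_map_eq_of_infinite fun n => A.profile (wpow u n)
  wlog hlt : i < j generalizing i j
  · exact this j i hij.symm h.symm (by omega)
  refine ⟨i, j - i, by omega, fun m => ?_⟩
  induction m with
  | zero => rfl
  | succ m ih =>
    have e : i + (j - i) * (m + 1) = (i + (j - i) * m) + (j - i) := by ring
    rw [e, wpow_add, A.profile_append_congr ih rfl, ← wpow_add, Nat.add_sub_cancel' hlt.le, ← h]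

/-- Some positive power of a word has an idempotent profile. -/
theorem exists_profile_idempotent [Finite Q] [Finite X] (A : CRA S α Q X) (u : List α) :
    ∃ t, A.profile (wpow u (t + 1) ++ wpow u (t + 1)) = A.profile (wpow u (t + 1)) := by
  obtain ⟨i, p, hp, h⟩ := A.exists_profile_periodic u
  -- A positive multiple of the period, beyond the preperiod.
  obtain ⟨t, ht⟩ : ∃ t, p * (i + 1) = t + 1 :=
    Nat.exists_eq_add_one.2 (Nat.mul_pos hp i.succ_pos)
  have hi : i ≤ t + 1 := by nlinarith
  refine ⟨t, ?_⟩
  have key : A.profile (wpow u ((i + p * (i + 1)) + (t + 1 - i))) =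
      A.profile (wpow u (i + (t + 1 - i))) := by
    rw [wpow_add _ (i + _), wpow_add _ i (t + 1 - i)]
    exact A.profile_append_congr (h _) rfl
  rw [← wpow_add]
  convert key using 3 <;> omega

end CRA

/-! ### Iterating a substitution with idempotent flow -/

/-- Let `T` and `T'` be the actions on valuations of two substitutions with the same idempotent
flow `R`. On the valuations `T ^ 2 (T' (T ^ (i + 1) ν))`, an output above a threshold independent of
`i` still grows under a further application of `T`. -/
theorem idempotent_flow_bound {X : Type} {R : X → X → Prop} {σ τ : Subst MaxPlus X}
    (hσ : σ.IsCopyless) (hflow : ∀ x y, x ∈ (σ y).vars ↔ R x y)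
    (hτ : ∀ x y, x ∈ (τ y).vars ↔ R x y)
    (hR : ∀ x z, R x z ↔ ∃ y, R x y ∧ R y z) (out : Expr MaxPlus X) (ν : X → MaxPlus) :
    ∃ D : MaxPlus, ∀ i : ℕ,
      let T : (X → MaxPlus) → X → MaxPlus := fun ν x => (σ x).eval ν
      let T' : (X → MaxPlus) → X → MaxPlus := fun ν x => (τ x).eval ν
      let κ := T (T (T' (T^[i] (T ν))))
      out.eval κ ≤ D ∨ MaxPlus.ofNat 1 * out.eval κ ≤ out.eval (T κ) := by
  classical
  have hfun {x y z : X} (h : R x y) (h' : R x z) : y = z :=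
    hσ.eq_of_mem ((hflow x y).2 h) ((hflow x z).2 h')
  have hfix {x y : X} (h : R x y) : R y y := by
    obtain ⟨z, hxz, hzy⟩ := (hR x y).1 h
    exact hfun hxz h ▸ hzy
  set T : (X → MaxPlus) → X → MaxPlus := fun ν x => (σ x).eval ν with hT
  set T' : (X → MaxPlus) → X → MaxPlus := fun ν x => (τ x).eval ν with hT'
  -- Registers off the diagonal of the flow are constant after one application of `σ`.
  have hconst (x : X) (hx : ¬ R x x) (ν₁ ν₂ : X → MaxPlus) : T ν₁ x = T ν₂ x :=
    (σ x).eval_congr fun z hz => absurd (hfix ((hflow z x).1 hz)) hx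
  -- The others are updated by an affine map, from the second application on.
  have haff (y : X) : ∃ p q : MaxPlus, R y y → ∀ μ, T (T μ) y = p + q * T μ y := by
    obtain ⟨p, q, h⟩ := (hσ.1 y).exists_affine y (T ν)
    refine ⟨p, q, fun _ μ => h (T μ) fun x hx hxy => hconst x (fun hxx => hxy ?_) _ _⟩
    exact hfun hxx ((hflow x y).1 hx)
  choose p q hpq using haff
  -- The registers that grow strictly.
  let Y : Set X := {y | R y y ∧ ¬ q y ≤ 1}
  -- Registers outside `Y` receive values only from registers outside `Y`.
  have hoff {x y : X} (h : R x y) (hy : y ∉ Y) : x ∉ Y := fun hx =>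
    hy (hfun hx.1 h ▸ hx)
  -- Outside `Y` the slope `q y` is at most one, so that `max (p y, ν y)` is an invariant bound.
  have hiter (i : ℕ) (y : X) (hy : y ∉ Y) : T^[i] (T ν) y ≤ p y + T ν y := by
    induction i with
    | zero => exact MaxPlus.le_add_left _ _
    | succ i ih =>
      have hi : T^[i] (T ν) = T (T^[i] ν) := by
        rw [← Function.iterate_succ_apply, Function.iterate_succ_apply']
      rw [Function.iterate_succ_apply']
      by_cases hyy : R y y
      · rw [hi, hpq y hyy, ← hi]
        have hq : q y ≤ 1 := not_not.1 fun h => hy ⟨hyy, h⟩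
        refine MaxPlus.add_le_iff.2 ⟨MaxPlus.le_add_right _ _, ?_⟩
        simpa using (MaxPlus.mul_mono hq le_rfl).trans ((one_mul _).le.trans ih)
      · rw [hconst y hyy _ ν]
        exact MaxPlus.le_add_left _ _
  have hTle {μ C : X → MaxPlus} (h : ∀ y ∉ Y, μ y ≤ C y) : ∀ y ∉ Y, T μ y ≤ T C y :=
    fun y hy => (σ y).eval_mono fun x hx => h x (hoff ((hflow x y).1 hx) hy)
  have hTle' {μ C : X → MaxPlus} (h : ∀ y ∉ Y, μ y ≤ C y) : ∀ y ∉ Y, T' μ y ≤ T' C y :=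
    fun y hy => (τ y).eval_mono fun x hx => h x (hoff ((hτ x y).1 hx) hy)
  obtain ⟨D, hD⟩ := out.exists_threshold Y (T (T (T' fun y => p y + T ν y)))
  refine ⟨D, fun i => hD _ _ (hTle (hTle (hTle' (hiter i)))) (fun y => ?_) fun y hy => ?_⟩
  -- No register decreases. For slope `-∞` this uses that `T` was applied twice after `T'`: the value
  -- is then already `p y`.
  · by_cases hyy : R y y
    · rw [hpq y hyy (T _)]
      by_cases hq : q y = 0
      · rw [hpq y hyy, hq]
        simp
      · refine le_trans ?_ (MaxPlus.le_add_left _ _)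
        simpa using MaxPlus.mul_mono (MaxPlus.one_le_of_ne_zero hq) (le_refl (T (T _) y))
    · exact (hconst y hyy _ _).le
  · rw [hpq y hy.1 (T _)]
    exact (MaxPlus.mul_mono (MaxPlus.ofNat_one_le_of_not_le hy.2) le_rfl).trans
      (MaxPlus.le_add_left _ _)

/-- For a copyless CRA, let `v` have an idempotent profile, shared by `v'`. If its output on
`v ^ (i + 2) v' v ^ 2` exceeds a bound independent of `i`, then the output grows when another `v` is
appended. -/
theorem CRA.IsCopyless.exists_bound {α Q X : Type} {A : CRA MaxPlus α Q X} (hA : A.IsCopyless)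
    {v v' : List α} (hv : A.profile (v ++ v) = A.profile v) (hv' : A.profile v' = A.profile v) :
    ∃ D : MaxPlus, ∀ i : ℕ,
      A.eval (wpow v (i + 2) ++ (v' ++ wpow v 2)) ≤ D ∨
      MaxPlus.ofNat 1 * A.eval (wpow v (i + 2) ++ (v' ++ wpow v 2)) ≤
        A.eval (wpow v (i + 2) ++ (v' ++ wpow v 3)) := by
  -- By idempotency, `v` and `v'` lead from `q` back to `q`.
  set q := (A.profile v A.start).1 with hq
  have hqv : (A.profile v q).1 = q := by
    conv_rhs => rw [hq, ← hv, profile_append]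
  have hqv' : (A.profile v' q).1 = q := by rw [hv', hqv]
  have hidem (x z : X) : (A.profile v q).2 x z ↔
      ∃ y, (A.profile v q).2 x y ∧ (A.profile v q).2 y z := by
    conv_lhs => rw [← hv, profile_append, hqv]
  obtain ⟨D, hD⟩ := idempotent_flow_bound (hA.trans q v) (R := (A.profile v q).2)
    (τ := (A.trans q v').2) (fun x y => Iff.rfl)
    (fun x y => by rw [← hv']; exact Iff.rfl) hidem (A.output q)
    (fun x => ((A.trans A.start v).2 x).eval A.initVal)
  refine ⟨D, fun i => ?_⟩
  have hstep (ν : X → MaxPlus) : v.foldl A.next (q, ν) =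
      (q, fun x => ((A.trans q v).2 x).eval ν) := by
    rw [A.foldl_next]; exact Prod.ext hqv rfl
  have hstep' (ν : X → MaxPlus) : v'.foldl A.next (q, ν) =
      (q, fun x => ((A.trans q v').2 x).eval ν) := by
    rw [A.foldl_next]; exact Prod.ext hqv' rfl
  have hpow (ν : X → MaxPlus) (n : ℕ) : (wpow v n).foldl A.next (q, ν) =
      (q, (fun ν x => ((A.trans q v).2 x).eval ν)^[n] ν) := by
    induction n generalizing ν with
    | zero => rfl
    | succ n ih => rw [wpow_succ, List.foldl_append, hstep, ih, Function.iterate_succ_apply]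
  have hstart : v.foldl A.next (A.start, A.initVal) =
      (q, fun x => ((A.trans A.start v).2 x).eval A.initVal) := by
    rw [A.foldl_next]; rfl
  have hrun (r : ℕ) : A.run (wpow v (i + 2) ++ (v' ++ wpow v r)) = 
      (q, (fun ν x => ((A.trans q v).2 x).eval ν)^[r] fun x => ((A.trans q v').2 x).eval
        ((fun ν x => ((A.trans q v).2 x).eval ν)^[i + 1]
          fun x => ((A.trans A.start v).2 x).eval A.initVal)) := by
    rw [CRA.run, List.foldl_append, List.foldl_append, wpow_succ, List.foldl_append, hstart,
      hpow, hstep', hpow]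
  simp only [CRA.eval, hrun]
  exact hD i

/-! ### Weighted automata: evaluation and number of runs -/

namespace WeightedAutomaton

variable {S α Q : Type} [CommSemiring S] [Fintype Q]

/-- The sum of the weights, without the initial weight, of all paths that read `w` from `q`. -/
def val (A : WeightedAutomaton S α Q) : List α → Q → S
  | [], q => A.final q
  | l :: w, q => ∑ q', A.weight q l q' * A.val w q'

/-- The sum is over all state sequences, with an arbitrary initial weight function `c`. -/
theorem sum_paths (A : WeightedAutomaton S α Q) (w : List α) (c : Q → S) :
    ∑ ρ : Fin (w.length + 1) → Q,
      c (ρ 0) * (∏ i : Fin w.length, A.weight (ρ i.castSucc) (w.get i) (ρ i.succ)) *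
        A.final (ρ (Fin.last w.length)) = ∑ q, c q * A.val w q := by
  induction w generalizing c with
  | nil =>
    refine Fintype.sum_equiv (Equiv.funUnique (Fin 1) Q) _ _ fun ρ => ?_
    simp [val]
  | cons l w ih =>
    have h := ih fun q' => ∑ q, c q * A.weight q l q'
    calc _ = ∑ x : Q × (Fin (w.length + 1) → Q), c x.1 * (A.weight x.1 l (x.2 0) *
            ∏ i : Fin w.length, A.weight (x.2 i.castSucc) (w.get i) (x.2 i.succ)) *
            A.final (x.2 (Fin.last w.length)) := ?_
      _ = _ := ?_
      _ = _ := h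
      _ = _ := ?_
    · refine (Fintype.sum_equiv (Fin.consEquiv fun _ : Fin (w.length + 2) => Q) _ _
        fun x => ?_).symm
      let ρ : Fin (w.length + 2) → Q := Fin.cons x.1 x.2
      exact congrArg (fun s => c x.1 * s * A.final (x.2 (Fin.last w.length)))
        (Fin.prod_univ_succ (n := w.length) fun i : Fin (w.length + 1) =>
          A.weight (ρ i.castSucc) ((l :: w).get i) (ρ i.succ)).symm
    · rw [Fintype.sum_prod_type_right]
      refine Finset.sum_congr rfl fun ρ _ => ?_
      rw [Finset.sum_mul, Finset.sum_mul]
      exact Finset.sum_congr rfl fun q _ => by ring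
    · simp only [val, Finset.mul_sum, Finset.sum_mul]
      rw [Finset.sum_comm]
      simp only [mul_assoc]

theorem eval_eq_sum_val (A : WeightedAutomaton S α Q) (w : List α) :
    A.eval w = ∑ q, A.init q * A.val w q := by
  classical
  rw [← A.sum_paths w A.init, eval, runs]
  refine Finset.sum_filter_of_ne fun ρ _ h => ⟨fun h0 => h ?_, fun i h0 => h ?_, fun h0 => h ?_⟩
  · simp [runWeight, h0]
  · simp only [runWeight]
    rw [Finset.prod_eq_zero (Finset.mem_univ i) h0, mul_zero, zero_mul]
  · simp [runWeight, h0]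

open Classical in
/-- The automaton over `ℕ` that counts accepting runs: nonzero weights are replaced by `1`. -/
noncomputable def support (A : WeightedAutomaton S α Q) : WeightedAutomaton ℕ α Q where
  weight p l q := if A.weight p l q = 0 then 0 else 1
  init q := if A.init q = 0 then 0 else 1
  final q := if A.final q = 0 then 0 else 1

theorem card_runs (A : WeightedAutomaton S α Q) (w : List α) :
    (A.runs w).card = ∑ q, A.support.init q * A.support.val w q := by
  classical
  rw [← A.support.sum_paths w, runs, Finset.card_filter]
  refine Finset.sum_congr rfl fun ρ _ => ?_
  split_ifs with h
  · obtain ⟨h1, h2, h3⟩ := h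
    simp only [support, h1, h2, h3, if_false, Finset.prod_const_one, mul_one]
  · symm
    by_contra h0
    simp only [mul_eq_zero, not_or, Finset.prod_eq_zero_iff, not_exists, support,
      ite_eq_left_iff, one_ne_zero, imp_false, not_not, Finset.mem_univ, true_and] at h0
    exact h ⟨h0.1.1, h0.1.2, h0.2⟩

end WeightedAutomaton

/-! ### The function that separates the classes -/

open MaxPlus Letter

/-- The automaton whose value on `w` is the maximum, over all factorizations `w = x # u # y` with
no `#` in `u`, of the number of `b` in `x` plus the number of `a` in `u`. The states `0`, `1`, `2`
read `x`, `u`, `y`. -/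
def blockWA : WeightedAutomaton MaxPlus Letter (Fin 3) where
  weight
    | 0, a, 0 => 1
    | 0, b, 0 => ofNat 1
    | 0, sharp, 0 => 1
    | 0, sharp, 1 => 1
    | 1, a, 1 => ofNat 1
    | 1, b, 1 => 1
    | 1, sharp, 2 => 1
    | 2, _, 2 => 1
    | _, _, _ => 0
  init := ![1, 0, 0]
  final := ![0, 0, 1]

theorem blockWA_eval (w : List Letter) : blockWA.eval w = blockWA.val w 0 := by
  simp [WeightedAutomaton.eval_eq_sum_val, Fin.sum_univ_three, blockWA]

theorem blockWA_val_two (w : List Letter) : blockWA.val w 2 = 1 := by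
  induction w with
  | nil => rfl
  | cons l w ih =>
    simp only [WeightedAutomaton.val, Fin.sum_univ_three, ih]
    simp [blockWA]

theorem blockWA_val_zero_cons (l : Letter) (w : List Letter) : blockWA.val (l :: w) 0 =
    match l with
    | a => blockWA.val w 0
    | b => ofNat 1 * blockWA.val w 0
    | sharp => blockWA.val w 0 + blockWA.val w 1 := by
  rw [WeightedAutomaton.val, Fin.sum_univ_three]
  cases l <;> simp [blockWA]

theorem blockWA_val_one_cons (l : Letter) (w : List Letter) : blockWA.val (l :: w) 1 =
    match l with
    | a => ofNat 1 * blockWA.val w 1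
    | b => blockWA.val w 1
    | sharp => 1 := by
  rw [WeightedAutomaton.val, Fin.sum_univ_three, blockWA_val_two]
  cases l <;> simp [blockWA]

theorem blockWA_isLinearlyAmbiguous : blockWA.IsLinearlyAmbiguous := by
  -- Only a `#` read in state `0` leaves a choice, and the rest of the run is then determined.
  have h2 (w : List Letter) : blockWA.support.val w 2 ≤ 1 := by
    induction w with
    | nil => simp [WeightedAutomaton.val, WeightedAutomaton.support, blockWA]
    | cons l w ih =>
      simpa [WeightedAutomaton.val, Fin.sum_univ_three, WeightedAutomaton.support, blockWA]
        using ih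
  have h1 (w : List Letter) : blockWA.support.val w 1 ≤ 1 := by
    induction w with
    | nil => simp [WeightedAutomaton.val, WeightedAutomaton.support, blockWA]
    | cons l w ih =>
      have := h2 w
      rw [WeightedAutomaton.val, Fin.sum_univ_three]
      cases l <;> simp [WeightedAutomaton.support, blockWA, ofNat_ne_zero] at * <;> assumption
  have h0 (w : List Letter) : blockWA.support.val w 0 ≤ w.length := by
    induction w with
    | nil => simp [WeightedAutomaton.val, WeightedAutomaton.support, blockWA]
    | cons l w ih =>
      have := h1 w
      rw [WeightedAutomaton.val, Fin.sum_univ_three, List.length_cons]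
      cases l <;> simp [WeightedAutomaton.support, blockWA, ofNat_ne_zero] at * <;> omega
  refine ⟨1, 0, fun w => ?_⟩
  rw [blockWA.card_runs, Fin.sum_univ_three]
  simpa [WeightedAutomaton.support, blockWA] using h0 w

/-- The copyless automaton that computes the function of `blockWA` on reversed words. While the
input is read, the register `true` counts the letters `a` since the last `#` (it is `-∞` before the
first `#`), and the register `false` holds the maximum over the completed blocks, shifted by the
number of `b` read since. -/
def blockCRA : CRA MaxPlus Letter Unit Bool where
  step _ l := ((), match l with
    | a => fun
      | false => .var false
      | true => .mul (.const (ofNat 1)) (.var true)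
    | b => fun
      | false => .mul (.const (ofNat 1)) (.var false)
      | true => .var true
    | sharp => fun
      | false => .add (.var false) (.var true)
      | true => .const 1)
  start := ()
  initVal _ := 0
  output _ := .var false

theorem blockCRA_isCopyless : blockCRA.IsCopyless := by
  refine ⟨fun _ l => ⟨fun x => ?_, fun x y h => ?_⟩, fun _ => ?_⟩
  · cases l <;> cases x <;> simp [blockCRA, Expr.IsCopyless, Expr.vars]
  · cases l <;> cases x <;> cases y <;> simp_all [blockCRA, Expr.vars]
  · simp [blockCRA, Expr.IsCopyless, Expr.vars]

theorem blockCRA_run_reverse (w : List Letter) :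
    (blockCRA.run w.reverse).2 false = blockWA.val w 0 ∧
      (blockCRA.run w.reverse).2 true = blockWA.val w 1 := by
  induction w with
  | nil => exact ⟨rfl, rfl⟩
  | cons l w ih =>
    rw [blockWA_val_zero_cons, blockWA_val_one_cons, ← ih.1, ← ih.2]
    simp only [CRA.run, List.foldl_reverse, List.foldr_cons]
    cases l <;> exact ⟨rfl, rfl⟩

theorem blockCRA_eval_reverse (w : List Letter) : blockCRA.eval w.reverse = blockWA.eval w := by
  rw [blockWA_eval, ← (blockCRA_run_reverse w).1]
  rfl

/-- The word `b # a^k #`. -/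
def block (k : ℕ) : List Letter := [b, sharp] ++ (wpow [a] k ++ [sharp])

theorem blockWA_val_wpow_a (k : ℕ) (w : List Letter) :
    blockWA.val (wpow [a] k ++ w) 0 = blockWA.val w 0 ∧
      blockWA.val (wpow [a] k ++ w) 1 = ofNat k * blockWA.val w 1 := by
  induction k with
  | zero => exact ⟨rfl, (one_mul _).symm⟩
  | succ k ih =>
    rw [wpow_succ, List.append_assoc, List.singleton_append, blockWA_val_zero_cons,
      blockWA_val_one_cons]
    exact ⟨ih.1, by simp only [ih.2, ← mul_assoc, ofNat_mul, Nat.add_comm]⟩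

theorem blockWA_val_block_zero (k : ℕ) (w : List Letter) :
    blockWA.val (block k ++ w) 0 =
      ofNat 1 * (blockWA.val w 0 + blockWA.val w 1 + ofNat k) := by
  simp only [block, List.append_assoc, List.cons_append, List.nil_append, blockWA_val_zero_cons,
    blockWA_val_wpow_a, blockWA_val_one_cons, mul_one]

theorem blockWA_val_block_one (k : ℕ) (w : List Letter) : blockWA.val (block k ++ w) 1 = 1 := by
  simp only [block, List.append_assoc, List.cons_append, List.nil_append, blockWA_val_one_cons]

theorem blockWA_val_wpow_block_le (k r : ℕ) :
    blockWA.val (wpow (block k) r) 0 ≤ ofNat (k + r) ∧ blockWA.val (wpow (block k) r) 1 ≤ 1 := by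
  induction r with
  | zero => exact ⟨zero_le _, zero_le _⟩
  | succ r ih =>
    rw [wpow_succ, blockWA_val_block_zero, blockWA_val_block_one]
    refine ⟨?_, le_rfl⟩
    have : blockWA.val (wpow (block k) r) 0 + blockWA.val (wpow (block k) r) 1 + ofNat k ≤
        ofNat (k + r) := add_le_iff.2 ⟨add_le_iff.2 ⟨ih.1, ih.2.trans (ofNat_le.2 (Nat.zero_le _))⟩,
          ofNat_le.2 (by omega)⟩
    refine (mul_mono le_rfl this).trans ?_
    rw [ofNat_mul]
    exact ofNat_le.2 (by omega)

/-- The value does not depend on `r`: the long block of `a` in the middle dominates everything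
after it, but all blocks before it contribute. -/
theorem blockWA_eval_block {k r M : ℕ} (h : k + r ≤ M) (n : ℕ) :
    blockWA.eval (wpow (block k) n ++ (block M ++ wpow (block k) r)) = ofNat (n + 1 + M) := by
  rw [blockWA_eval]
  suffices blockWA.val (wpow (block k) n ++ (block M ++ wpow (block k) r)) 0 = ofNat (n + 1 + M) ∧
    blockWA.val (wpow (block k) n ++ (block M ++ wpow (block k) r)) 1 = 1 from this.1
  induction n with
  | zero =>
    rw [wpow_zero, List.nil_append, blockWA_val_block_zero, blockWA_val_block_one]
    obtain ⟨h0, h1⟩ := blockWA_val_wpow_block_le k r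
    rw [add_eq_right (add_le_iff.2 ⟨h0.trans (ofNat_le.2 h),
      h1.trans (ofNat_le.2 M.zero_le)⟩), ofNat_mul, Nat.zero_add]
    exact ⟨rfl, rfl⟩
  | succ n ih =>
    rw [wpow_succ, List.append_assoc, blockWA_val_block_zero, blockWA_val_block_one, ih.1, ih.2,
      add_eq_left (y := 1) (ofNat_le.2 (Nat.zero_le _)), add_eq_left (ofNat_le.2 (by omega)),
      ofNat_mul]
    exact ⟨by congr 1; omega, rfl⟩

/-! ### No copyless automaton computes it -/

theorem blockWA_eval_not_mem_copylessCRA :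
    (fun w => blockWA.eval w) ∉ copylessCRA MaxPlus Letter := by
  rintro ⟨Q, X, _, _, A, hA, hf⟩
  obtain ⟨k, p, hp, hk⟩ := A.exists_profile_periodic [a]
  obtain ⟨t, ht⟩ := A.exists_profile_idempotent (block k)
  -- `M` is so large that the block with `M` letters `a` dominates the `4 * t + 3` blocks after it.
  set M := k + p * (4 * (t + 1)) with hM
  have hle : k + 4 * (t + 1) ≤ M := by nlinarith
  have hprof : A.profile (block M ++ wpow (block k) t) = A.profile (wpow (block k) (t + 1)) := by
    rw [wpow_succ]
    exact A.profile_append_congr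
      (A.profile_append_congr rfl (A.profile_append_congr (hk _) rfl)) rfl
  obtain ⟨D, hD⟩ := hA.exists_bound ht hprof
  have hval (i r : ℕ) (hr : r ≤ 3) :
      A.eval (wpow (wpow (block k) (t + 1)) (i + 2) ++ ((block M ++ wpow (block k) t) ++
        wpow (wpow (block k) (t + 1)) r)) = ofNat ((t + 1) * (i + 2) + 1 + M) := by
    rw [← hf, wpow_mul, wpow_mul, List.append_assoc, ← wpow_add]
    exact blockWA_eval_block (by nlinarith) _
  obtain ⟨d, hd⟩ := exists_le_ofNat D
  rcases hD d with h | h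
  · rw [hval d 2 (by norm_num)] at h
    have := ofNat_le.1 (h.trans hd)
    nlinarith
  · rw [hval d 2 (by norm_num), hval d 3 le_rfl, ofNat_mul] at h
    have := ofNat_le.1 h
    omega

end CopylessCRA

theorem mainTheorem2 :
    (¬ CopylessCRA.linearlyAmbiguousWA CopylessCRA.MaxPlus CopylessCRA.Letter ⊆
        CopylessCRA.copylessCRA CopylessCRA.MaxPlus CopylessCRA.Letter) ∧
      ¬ CopylessCRA.ClosedUnderReverse
        (CopylessCRA.copylessCRA CopylessCRA.MaxPlus CopylessCRA.Letter) := by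
  refine ⟨fun h => ?_, fun h => ?_⟩
  · exact CopylessCRA.blockWA_eval_not_mem_copylessCRA
      (h ⟨Fin 3, inferInstance, CopylessCRA.blockWA, CopylessCRA.blockWA_isLinearlyAmbiguous,
        fun _ => rfl⟩)
  · obtain ⟨g, hg, hgf⟩ := h (fun w => CopylessCRA.blockCRA.eval w)
      ⟨Unit, Bool, inferInstance, inferInstance, CopylessCRA.blockCRA,
        CopylessCRA.blockCRA_isCopyless, fun _ => rfl⟩
    have : g = fun w => CopylessCRA.blockWA.eval w :=
      funext fun w => (hgf w).trans (CopylessCRA.blockCRA_eval_reverse w)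
    exact CopylessCRA.blockWA_eval_not_mem_copylessCRA (this ▸ hg)
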